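/- For an odd prime $p$, an integer $n\ge 2$ and $a,b\in\mathbb{Z}/p^n\mathbb{Z}$ let $$\mathsf{Kl}_{p^n}(a,b)=\frac{1}{p^{n/2}}\sum_{x\in(\mathbb{Z}/p^n\mathbb{Z})^\times}\exp\left(\frac{2\pi i\,(ax+b\overline{x})}{p^n}\right),$$ where $\overline{x}$ is the inverse of $x$ modulo $p^n$. For a function $\mu:\mathbb{Z}/p^n\mathbb{Z}\to\mathbb{Z}_{\ge 0}$ let $\mathsf{T}(\mu)=\{\tau\in\mathbb{Z}/p^n\mathbb{Z} : \mu(\tau)\ge 1\}$ and $$\mathsf{A}_{p^n}(\mu)=\left\{a\in(\mathbb{Z}/p^n\mathbb{Z})^\times : a+\tau\in\left((\mathbb{Z}/p^n\mathbb{Z})^\times\right)^2\text{ for every }\tau\in\mathsf{T}(\mu)\right\}.$$ For $b_0\in(\mathbb{Z}/p^n\mathbb{Z})^\times$ let $b_0\cdot\mu$ be the function $\tau\mapsto\mu(\overline{b_0}\tau)$, so that $\mathsf{T}(b_0\cdot\mu)=b_0\mathsf{T}(\mu)$, and let $\delta_{2\mid m}$ be $1$ if $m$ is even and $0$ otherwise.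 **Proposition (Moments of shifted Kloosterman sums).** For every integer $M\ge 0$ and every real $\varepsilon>0$ there is a constant $C$, depending only on $M$ and $\varepsilon$, with the following property. Let $p$ be an odd prime and $n\ge 2$ an integer with $p>\max(M,2n-5)$, let $b_0\in(\mathbb{Z}/p^n\mathbb{Z})^\times$, and let $\mu:\mathbb{Z}/p^n\mathbb{Z}\to\mathbb{Z}_{\ge 0}$ satisfy $\sum_\tau\mu(\tau)\le M$ and be such that the elements of $\mathsf{T}(\mu)$ are pairwise distinct modulo $p$. Then $$\left|\frac{1}{\varphi(p^n)}\sum_{a\in(\mathbb{Z}/p^n\mathbb{Z})^\times}\ \prod_{\tau\in\mathbb{Z}/p^n\mathbb{Z}}\mathsf{Kl}_{p^n}(a+\tau,b_0)^{\mu(\tau)}-\left[\prod_{\tau\in\mathbb{Z}/p^n\mathbb{Z}}\delta_{2\mid\mu(\tau)}\binom{\mu(\tau)}{\mu(\tau)/2}\right]\frac{|\mathsf{A}_{p^n}(b_0\cdot\mu)|}{\varphi(p^n)}\right|\le C\,p^{-\frac{4(n-1)}{2^n}+\varepsilon}.$$ If moreover $b_0$ is a square in $(\mathbb{Z}/p^n\mathbb{Z})^\times$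 (for instance $b_0=1$), then the same inequality holds with $|\mathsf{A}_{p^n}(\mu)|$ in place of $|\mathsf{A}_{p^n}(b_0\cdot\mu)|$. -/

import Mathlib

open scoped BigOperators

noncomputable section

namespace ShiftedKloosterman

/-- The normalized Kloosterman sum
`Kl_{p^n}(a, b) = p^{-n/2} ∑_x e((a x + b x⁻¹) / p^n)`, the sum being over the invertible residue
classes `x` modulo `p^n`. Here `ZMod.stdAddChar` is the additive character `y ↦ e(y / p^n)`. -/
def kl (p n : ℕ) [Fact p.Prime] (a b : ZMod (p ^ n)) : ℂ :=
  (1 / (Real.sqrt ((p : ℝ) ^ n) : ℂ)) *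
    ∑ x : (ZMod (p ^ n))ˣ,
      ZMod.stdAddChar (a * (x : ZMod (p ^ n)) + b * ((x⁻¹ : (ZMod (p ^ n))ˣ) : ZMod (p ^ n)))

/-- `S_{p^n}(μ; b₀)`: the average over the invertible `a` modulo `p^n` of
`∏_τ Kl_{p^n}(a + τ, b₀)^{μ(τ)}`. -/
def moment (p n : ℕ) [Fact p.Prime] (μ : ZMod (p ^ n) → ℕ) (b₀ : (ZMod (p ^ n))ˣ) : ℂ :=
  (1 / (Nat.totient (p ^ n) : ℂ)) *
    ∑ a : (ZMod (p ^ n))ˣ,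
      ∏ τ : ZMod (p ^ n), kl p n ((a : ZMod (p ^ n)) + τ) (b₀ : ZMod (p ^ n)) ^ μ τ

/-- `T(μ)`: the set of the `τ` modulo `p^n` with `μ(τ) ≥ 1`. -/
def shifts (p n : ℕ) [Fact p.Prime] (μ : ZMod (p ^ n) → ℕ) : Finset (ZMod (p ^ n)) :=
  Finset.univ.filter fun τ => 1 ≤ μ τ

/-- The set of the reductions modulo `p` of the elements of `T(μ)`
(`ZMod.cast` is the reduction map, as `p` divides `p^n` for `n ≥ 1`). -/
def shiftsMod (p n : ℕ) [Fact p.Prime] (μ : ZMod (p ^ n) → ℕ) : Finset (ZMod p) :=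
  (shifts p n μ).image fun τ => (τ.cast : ZMod p)

/-- `A_{p^n}(μ)`: the invertible `a` modulo `p^n` such that `a + τ` is the square of an invertible
class for every `τ ∈ T(μ)`. -/
def squareSet (p n : ℕ) [Fact p.Prime] (μ : ZMod (p ^ n) → ℕ) : Set (ZMod (p ^ n))ˣ :=
  {a | ∀ τ ∈ shifts p n μ, ∃ u : (ZMod (p ^ n))ˣ, (a : ZMod (p ^ n)) + τ = (u : ZMod (p ^ n)) ^ 2}

/-- The multiplicities transported by multiplication by `b₀`: `b₀ τ` receives the multiplicity
`μ(τ)`. -/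
def dilate (p n : ℕ) [Fact p.Prime] (b₀ : (ZMod (p ^ n))ˣ) (μ : ZMod (p ^ n) → ℕ) :
    ZMod (p ^ n) → ℕ :=
  fun τ => μ (((b₀⁻¹ : (ZMod (p ^ n))ˣ) : ZMod (p ^ n)) * τ)

/-- `∏_τ δ_{2 ∣ μ(τ)} binom(μ(τ), μ(τ)/2)`. -/
def centralProduct (p n : ℕ) [Fact p.Prime] (μ : ZMod (p ^ n) → ℕ) : ℕ :=
  ∏ τ : ZMod (p ^ n), if 2 ∣ μ τ then (μ τ).choose (μ τ / 2) else 0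

end ShiftedKloosterman

end

/-!
The error term is in fact `O(1 / p)` with a constant depending only on `M`, which suffices because
`4 (n - 1) ≤ 2 ^ n`. Write `q = p ^ (n - 1)`, so that `q ^ 2 = 0` modulo `p ^ n`.

The substitution `x ↦ x (1 + q t)` shows that only the `x` with `a x ≡ b x⁻¹` modulo `p` contribute
to the Kloosterman sum (`kl_eq_sum_filter`). Hence it vanishes unless `a b = s ^ 2` for a unit `s`
(`kl_eq_zero`), and then it equals `z(s) + z(-s)` with
`z(s) = p ^ (-n / 2) ∑_{y ≡ 1 mod p} e (s (y + y⁻¹) / p ^ n)` (`kl_eq_localSum_add`). An explicit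
evaluation of `z` by Gauss sums is not needed, only that `z(-s)` is the conjugate of `z(s)`, that
`|z(s)| = 1` (`norm_localSum`) and that `z(s + q u) = z(s) e (2 q u / p ^ n)` (`localSum_add`).

Fix square roots `s_τ(a)` of `(a + τ) b₀` compatible with reduction modulo `p`, and expand the
product of the powers `(z(s_τ) + z(-s_τ)) ^ μ(τ)` by the binomial theorem. The balanced monomials,
in which `z(s_τ)` and `z(-s_τ)` occur equally often for every `τ`, are equal to `1` and make up the
main term. In any other monomial, `a ↦ a + q t` multiplies the term by `e (q t f'(a) / p ^ n)` with
`f'(a) = ∑ k_τ b₀ / s_τ(a)`, where the `k_τ` are integers of absolute value less than `p` and not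
all zero. So only the `a` with `f'(a) ≡ 0` modulo `p` contribute
(`sum_localMonomial_eq_sum_filter`). Taking the norm of `f'` over all choices of signs of the square
roots gives a polynomial over the field with `p` elements of bounded degree; it is nonzero because
the `τ` are distinct modulo `p` (`exists_polynomial_of_sum_div_sqrt_eq_zero`). This leaves a bounded
number of classes of `a` modulo `p`, each with `q` elements (`card_filter_phaseDeriv_le`).
-/

noncomputable section

/-! ### Zeros of sums of reciprocal square roots -/

namespace ShiftedKloosterman

open MvPolynomial in
/-- Substituting `e j * X j` for `X j` multiplies the coefficient at `m` by `∏ j, e j ^ m j`. -/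
theorem coeff_bind₁_C_mul_X {σ K : Type*} [Fintype σ] [Field K] (e : σ → K)
    (Q : MvPolynomial σ K) (m : σ →₀ ℕ) :
    coeff m (bind₁ (fun j => C (e j) * X j) Q) = coeff m Q * ∏ j, e j ^ m j := by
  classical
  induction Q using MvPolynomial.induction_on' with
  | monomial u a =>
    have h : bind₁ (fun j => C (e j) * X j) (monomial u a) =
        monomial u (a * ∏ j, e j ^ u j) := by
      rw [bind₁_monomial, ← Finsupp.prod.eq_1 u fun j k => (C (e j) * X j : MvPolynomial σ K) ^ k,
        Finsupp.prod_fintype _ _ (by simp), Finset.prod_congr rfl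
        (fun j _ => mul_pow (C (e j)) (X j : MvPolynomial σ K) (u j)), Finset.prod_mul_distrib]
      rw [monomial_eq (s := u), Finsupp.prod_fintype _ _ (by simp)]
      simp only [map_mul, map_prod, map_pow]
      ring
    rw [h, coeff_monomial, coeff_monomial]
    split_ifs with hu
    · rw [hu]
    · simp
  | add p q hp hq => rw [map_add, coeff_add, coeff_add, hp, hq, add_mul]

open MvPolynomial in
/-- A polynomial which is unchanged under all sign changes of its variables is a polynomial in
their squares. -/
theorem exists_expand_two_eq {σ K : Type*} [Fintype σ] [Field K] (h2 : (2 : K) ≠ 0)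
    (Q : MvPolynomial σ K)
    (hQ : ∀ e : σ → ℤˣ, bind₁ (fun j => C (((e j : ℤ) : K)) * X j) Q = Q) :
    ∃ Q' : MvPolynomial σ K, expand 2 Q' = Q := by
  classical
  have heven : ∀ m ∈ Q.support, ∀ i, Even (m i) := by
    intro m hm i
    by_contra hodd
    rw [Nat.not_even_iff_odd] at hodd
    have h := coeff_bind₁_C_mul_X
      (fun j => (((Function.update (1 : σ → ℤˣ) i (-1) j : ℤˣ) : ℤ) : K)) Q m
    rw [hQ, Finset.prod_eq_single i] at h
    · rw [Function.update_self] at h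
      simp only [Units.val_neg, Units.val_one, Int.cast_neg, Int.cast_one, hodd.neg_one_pow] at h
      have : 2 * coeff m Q = 0 := by linear_combination h
      exact (mem_support_iff.1 hm) ((mul_eq_zero.1 this).resolve_left h2)
    · intro j _ hj
      simp [Function.update_of_ne hj]
    · simp
  refine ⟨∑ m ∈ Q.support, monomial (m.mapRange (fun k => k / 2) rfl) (coeff m Q), ?_⟩
  conv_rhs => rw [Q.as_sum]
  rw [map_sum]
  refine Finset.sum_congr rfl fun m hm => ?_
  rw [expand_monomial]
  congr 2
  ext i
  obtain ⟨k, hk⟩ := heven m hm i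
  simp only [Finsupp.coe_smul, Pi.smul_apply, Finsupp.mapRange_apply, smul_eq_mul]
  omega

open MvPolynomial in
/-- A nontrivial relation `∑ i, k i / r i = 0` between square roots `r i` of the translates
`α + t i` confines `α` to the zeros of a nonzero polynomial, of degree bounded in terms of the
number of translates only. The polynomial is the norm of `∑ i, k i * ∏ j ≠ i, r j`, the product over
all choices of the signs of the `r i`; it does not vanish at `-t i`, where only one term
survives. -/
theorem exists_polynomial_of_sum_div_sqrt_eq_zero {ι K : Type*} [Fintype ι] [Nonempty ι] [Field K]
    [IsAlgClosed K] (h2 : (2 : K) ≠ 0) (t k : ι → K) (ht : Function.Injective t)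
    (hk : ∀ i, k i ≠ 0) :
    ∃ P : Polynomial K, P ≠ 0 ∧ P.natDegree ≤ 2 ^ Fintype.card ι * Fintype.card ι ∧
      ∀ (α : K) (r : ι → K), (∀ i, r i ≠ 0 ∧ r i ^ 2 = α + t i) → ∑ i, k i / r i = 0 →
        P.eval α = 0 := by
  classical
  let g : MvPolynomial ι K := ∑ i, C (k i) * ∏ j ∈ Finset.univ.erase i, X j
  let φ : (ι → ℤˣ) → MvPolynomial ι K →ₐ[K] MvPolynomial ι K := fun e =>
    bind₁ (fun j => C (((e j : ℤ) : K)) * X j)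
  let Q : MvPolynomial ι K := ∏ e : ι → ℤˣ, φ e g
  have hφ : ∀ d e : ι → ℤˣ, ∀ f, φ d (φ e f) = φ (e * d) f := by
    intro d e f
    simp only [φ, bind₁_bind₁]
    congr 2
    funext j
    simp [mul_assoc]
  have hQ : ∀ d, φ d Q = Q := by
    intro d
    simp only [Q, map_prod, hφ]
    exact Fintype.prod_equiv (Equiv.mulRight d) _ _ fun e => rfl
  have heval : ∀ e (r : ι → K), eval r (φ e g) =
      ∑ i, k i * ∏ j ∈ Finset.univ.erase i, (((e j : ℤ) : K) * r j) := by
    intro e r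
    simp [φ, g, map_sum, map_prod]
  obtain ⟨Q', hQ'⟩ := exists_expand_two_eq h2 Q hQ
  have hsq : ∀ r : ι → K, eval (r ^ 2) Q' = ∏ e, eval r (φ e g) := by
    intro r
    rw [← eval_expand, hQ', map_prod]
  let P : Polynomial K := aeval (fun i => Polynomial.X + Polynomial.C (t i)) Q'
  have hP : ∀ α, P.eval α = eval (fun i => α + t i) Q' := by
    intro α
    have : (Polynomial.evalRingHom α).comp
        (aeval (fun i => Polynomial.X + Polynomial.C (t i)) :
          MvPolynomial ι K →ₐ[K] Polynomial K).toRingHom = eval (fun i => α + t i) := by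
      ext <;> simp
    exact DFunLike.congr_fun this Q'
  have hdeg : ∀ e, (φ e g).totalDegree ≤ Fintype.card ι := by
    intro e
    simp only [φ, g, map_sum, map_mul, map_prod, bind₁_X_right, algHom_C]
    refine totalDegree_finsetSum_le fun i _ => ?_
    refine (totalDegree_mul _ _).trans ?_
    rw [MvPolynomial.algebraMap_eq, totalDegree_C, zero_add]
    refine (totalDegree_finsetProd _ _).trans ?_
    refine (Finset.sum_le_card_nsmul _ _ 1 fun j _ => ?_).trans ?_
    · refine (totalDegree_mul _ _).trans ?_
      rw [totalDegree_C, zero_add, totalDegree_X]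
    · rw [smul_eq_mul, mul_one]
      exact Finset.card_le_univ _
  refine ⟨P, ?_, ?_, ?_⟩
  · intro h0
    obtain ⟨i₀⟩ := (inferInstance : Nonempty ι)
    choose ρ hρ using fun i => IsAlgClosed.exists_pow_nat_eq (-t i₀ + t i) (n := 2) two_pos
    have hρ0 : ρ i₀ = 0 := by
      have := hρ i₀
      rw [neg_add_cancel] at this
      exact pow_eq_zero_iff two_ne_zero |>.1 this
    have hρne : ∀ j, j ≠ i₀ → ρ j ≠ 0 := by
      intro j hj h
      have := hρ j
      rw [h] at this
      exact hj (ht (by linear_combination -this))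
    have h1 : P.eval (-t i₀) = ∏ e, eval ρ (φ e g) := by
      rw [hP, ← hsq]
      congr 2
      funext i
      exact (hρ i).symm
    rw [h0, Polynomial.eval_zero] at h1
    obtain ⟨e, -, he⟩ := Finset.prod_eq_zero_iff.1 h1.symm
    rw [heval, Finset.sum_eq_single i₀] at he
    · refine mul_ne_zero (hk i₀) (Finset.prod_ne_zero_iff.2 fun j hj => ?_) he
      refine mul_ne_zero ?_ (hρne j (Finset.ne_of_mem_erase hj))
      rcases Int.units_eq_one_or (e j) with h | h <;> simp [h]
    · intro i _ hi
      rw [Finset.prod_eq_zero (i := i₀) (Finset.mem_erase.2 ⟨hi.symm, Finset.mem_univ _⟩)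
        (by rw [hρ0, mul_zero]), mul_zero]
    · simp
  · have h1 : P.natDegree ≤ Q'.totalDegree * 1 :=
      aeval_natDegree_le Q' le_rfl _ fun i => by compute_degree
    have h3 : Q'.totalDegree ≤ Q.totalDegree := by
      rw [← hQ', totalDegree_expand]
      exact Nat.le_mul_of_pos_right _ two_pos
    have h4 : Q.totalDegree ≤ 2 ^ Fintype.card ι * Fintype.card ι := by
      refine (totalDegree_finsetProd _ _).trans
        ((Finset.sum_le_card_nsmul _ _ _ fun e _ => hdeg e).trans ?_)
      simp
    omega
  · intro α r hr hsum
    have h1 : (fun i => α + t i) = r ^ 2 := by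
      funext i
      exact (hr i).2.symm
    rw [hP, h1, hsq]
    refine Finset.prod_eq_zero (Finset.mem_univ 1) ?_
    rw [heval]
    have h3 : ∀ i, k i * ∏ j ∈ Finset.univ.erase i, (((((1 : ι → ℤˣ) j : ℤˣ) : ℤ) : K) * r j) =
        (k i / r i) * ∏ j, r j := by
      intro i
      rw [← Finset.mul_prod_erase _ _ (Finset.mem_univ i), div_mul_eq_mul_div, mul_left_comm,
        mul_div_cancel_left₀ _ (hr i).1]
      simp
    rw [Finset.sum_congr rfl fun i _ => h3 i, ← Finset.sum_mul, hsum, zero_mul]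

/-! ### Residue classes modulo `p ^ n` and their reductions modulo `p` -/

section Residues

variable {p n : ℕ}

/-- The reduction map from `ℤ / p ^ n` to `ℤ / p`. -/
def red (p : ℕ) {n : ℕ} (hn : 2 ≤ n) : ZMod (p ^ n) →+* ZMod p :=
  ZMod.castHom (dvd_pow_self p (by omega)) (ZMod p)

variable (hn : 2 ≤ n)

theorem red_surjective : Function.Surjective (red p hn) :=
  ZMod.castHom_surjective _

variable [Fact p.Prime]

theorem red_eq_natCast (x : ZMod (p ^ n)) : red p hn x = ((x.val : ℕ) : ZMod p) := by
  rw [red, ZMod.castHom_apply, ZMod.cast_eq_val]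

theorem pow_pred_mul_eq_zero_iff (x : ZMod (p ^ n)) :
    (p : ZMod (p ^ n)) ^ (n - 1) * x = 0 ↔ red p hn x = 0 := by
  have hp : 0 < p := (Fact.out : p.Prime).pos
  rw [red_eq_natCast, ZMod.natCast_eq_zero_iff]
  conv_lhs => rw [← ZMod.natCast_zmod_val x]
  rw [← Nat.cast_pow, ← Nat.cast_mul, ZMod.natCast_eq_zero_iff]
  have h : p ^ n = p ^ (n - 1) * p := by rw [← pow_succ]; congr 1; omega
  generalize x.val = k
  rw [h]
  exact Nat.mul_dvd_mul_iff_left (pow_pos hp _)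

theorem isUnit_iff_red_ne_zero (x : ZMod (p ^ n)) : IsUnit x ↔ red p hn x ≠ 0 := by
  rw [red_eq_natCast, Ne, ZMod.natCast_eq_zero_iff]
  conv_lhs => rw [← ZMod.natCast_zmod_val x]
  rw [ZMod.isUnit_iff_coprime, Nat.coprime_pow_right_iff (by omega), Nat.coprime_comm,
    (Fact.out : p.Prime).coprime_iff_not_dvd]

theorem red_pow_pred : red p hn ((p : ZMod (p ^ n)) ^ (n - 1)) = 0 := by
  rw [map_pow, map_natCast, ZMod.natCast_self, zero_pow (by omega)]

theorem pow_pred_mul_self (hn : 2 ≤ n) :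
    (p : ZMod (p ^ n)) ^ (n - 1) * (p : ZMod (p ^ n)) ^ (n - 1) = 0 :=
  (pow_pred_mul_eq_zero_iff hn _).2 (red_pow_pred hn)

theorem pow_pred_mul_congr {x y : ZMod (p ^ n)} (h : red p hn x = red p hn y) :
    (p : ZMod (p ^ n)) ^ (n - 1) * x = (p : ZMod (p ^ n)) ^ (n - 1) * y := by
  rw [← sub_eq_zero, ← mul_sub, pow_pred_mul_eq_zero_iff hn, map_sub, h, sub_self]

theorem card_red_eq (α : ZMod p) :
    (Finset.univ.filter fun x : ZMod (p ^ n) => red p hn x = α).card = p ^ (n - 1) := by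
  have hp : 0 < p := (Fact.out : p.Prime).pos
  have h : ∀ β : ZMod p, (Finset.univ.filter fun x : ZMod (p ^ n) => red p hn x = β).card =
      (Finset.univ.filter fun x : ZMod (p ^ n) => red p hn x = α).card := fun β =>
    AddMonoidHom.card_fiber_eq_of_mem_range (red p hn) (red_surjective hn β) (red_surjective hn α)
  have h1 := Finset.card_eq_sum_card_fiberwise (f := red p hn)
    (s := (Finset.univ : Finset (ZMod (p ^ n)))) (t := Finset.univ) (by simp)
  rw [Finset.sum_congr rfl fun β _ => h β, Finset.sum_const, Finset.card_univ, Finset.card_univ,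
    ZMod.card, ZMod.card, smul_eq_mul] at h1
  have h2 : p ^ n = p * p ^ (n - 1) := by rw [← pow_succ']; congr 1; omega
  exact Nat.eq_of_mul_eq_mul_left hp (h1.symm.trans h2)

theorem two_ne_zero_of_ne_two (hp2 : p ≠ 2) : (2 : ZMod p) ≠ 0 := by
  intro h
  rw [show (2 : ZMod p) = ((2 : ℕ) : ZMod p) by norm_cast, ZMod.natCast_eq_zero_iff] at h
  exact hp2 ((Nat.prime_dvd_prime_iff_eq Fact.out Nat.prime_two).1 h)

theorem eq_of_sq_eq_sq_of_red_eq (hp2 : p ≠ 2) {x y : ZMod (p ^ n)} (hx : red p hn x ≠ 0)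
    (h : x ^ 2 = y ^ 2) (hr : red p hn x = red p hn y) : x = y := by
  have hu : IsUnit (x + y) := by
    rw [isUnit_iff_red_ne_zero hn, map_add, ← hr, ← two_mul]
    exact mul_ne_zero (two_ne_zero_of_ne_two hp2) hx
  rw [← sub_eq_zero, ← hu.mul_left_eq_zero]
  linear_combination h

/-- Hensel's lemma for squares, by counting: squaring is injective, hence bijective, between residue
classes modulo `p`. -/
theorem exists_sq_eq_of_red_eq_sq (hp2 : p ≠ 2) {c : ZMod (p ^ n)} {r : ZMod p} (hr : r ≠ 0)
    (hc : red p hn c = r ^ 2) : ∃ s : ZMod (p ^ n), s ^ 2 = c ∧ red p hn s = r := by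
  have hsurj := Finset.surjOn_of_injOn_of_card_le
    (s := Finset.univ.filter fun x : ZMod (p ^ n) => red p hn x = r)
    (t := Finset.univ.filter fun x : ZMod (p ^ n) => red p hn x = r ^ 2) (fun x => x ^ 2)
    (by
      intro x hx
      simp only [Finset.coe_filter, Finset.mem_univ, true_and, Set.mem_ofPred_eq] at hx ⊢
      rw [map_pow, hx])
    (by
      intro x hx y hy hxy
      simp only [Finset.coe_filter, Finset.mem_univ, true_and, Set.mem_ofPred_eq] at hx hy
      exact eq_of_sq_eq_sq_of_red_eq hn hp2 (by rwa [hx]) hxy (hx.trans hy.symm))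
    (by rw [card_red_eq, card_red_eq])
  obtain ⟨s, hs, hsc⟩ := hsurj (show c ∈ _ by simpa using hc)
  exact ⟨s, hsc, by simpa using hs⟩

theorem exists_unit_sq_eq_iff (hp2 : p ≠ 2) (c : ZMod (p ^ n)) :
    (∃ u : (ZMod (p ^ n))ˣ, c = (u : ZMod (p ^ n)) ^ 2) ↔
      red p hn c ≠ 0 ∧ IsSquare (red p hn c) := by
  constructor
  · rintro ⟨u, rfl⟩
    refine ⟨(isUnit_iff_red_ne_zero hn _).1 (u.isUnit.pow 2), ?_⟩
    rw [map_pow]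
    exact IsSquare.sq _
  · rintro ⟨h0, r, hr⟩
    have hr0 : r ≠ 0 := by
      rintro rfl
      exact h0 (by simpa using hr)
    obtain ⟨s, hs, hsr⟩ := exists_sq_eq_of_red_eq_sq hn hp2 hr0 (by rw [hr, sq])
    have hu : IsUnit s := (isUnit_iff_red_ne_zero hn s).2 (by rwa [hsr])
    exact ⟨hu.unit, by rw [hu.unit_spec, hs]⟩

/-- `σ` is a choice of square roots of the square units of `ℤ / p ^ n` that is compatible with
reduction modulo `p`. Its other values are arbitrary. -/
def IsCompatibleSqrt (p : ℕ) {n : ℕ} (hn : 2 ≤ n)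
    (σ : ZMod (p ^ n) → ZMod (p ^ n)) : Prop :=
  ∀ c, red p hn c ≠ 0 → IsSquare (red p hn c) →
    σ c ^ 2 = c ∧ ∀ c', red p hn c' = red p hn c → red p hn (σ c') = red p hn (σ c)

theorem exists_isCompatibleSqrt (hp2 : p ≠ 2) :
    ∃ σ : ZMod (p ^ n) → ZMod (p ^ n), IsCompatibleSqrt p hn σ := by
  classical
  have hρ : ∀ x : ZMod p, ∃ r, IsSquare x → x = r ^ 2 := by
    intro x
    by_cases hx : IsSquare x
    · obtain ⟨r, hr⟩ := hx
      exact ⟨r, fun _ => by rw [hr, sq]⟩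
    · exact ⟨0, fun h => absurd h hx⟩
  choose ρ hρ using hρ
  have hσ : ∀ c : ZMod (p ^ n), ∃ s, red p hn c ≠ 0 → IsSquare (red p hn c) →
      s ^ 2 = c ∧ red p hn s = ρ (red p hn c) := by
    intro c
    by_cases h : red p hn c ≠ 0 ∧ IsSquare (red p hn c)
    · have h1 := hρ _ h.2
      have h0 : ρ (red p hn c) ≠ 0 := by
        intro h0
        rw [h0] at h1
        exact h.1 (by simpa using h1)
      obtain ⟨s, hs⟩ := exists_sq_eq_of_red_eq_sq hn hp2 h0 h1
      exact ⟨s, fun _ _ => hs⟩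
    · exact ⟨0, fun h1 h2 => absurd ⟨h1, h2⟩ h⟩
  choose σ hσ using hσ
  refine ⟨σ, fun c h0 hs => ⟨(hσ c h0 hs).1, fun c' hc' => ?_⟩⟩
  rw [(hσ c h0 hs).2, (hσ c' (by rwa [hc']) (by rwa [hc'])).2, hc']

end Residues

/-! ### Localization of character sums -/

section Localization

variable {N : ℕ} [NeZero N]

/-- If, for every `t`, a sum is unchanged when its terms are multiplied by `e (t * c x / N)`, then
only the terms with `c x = 0` contribute. -/
theorem sum_eq_sum_filter_of_twist_invariant {X : Type*} (s : Finset X) (F : X → ℂ)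
    (c : X → ZMod N)
    (h : ∀ t, ∑ x ∈ s, F x = ∑ x ∈ s, F x * ZMod.stdAddChar (t * c x)) :
    ∑ x ∈ s, F x = ∑ x ∈ s.filter (fun x => c x = 0), F x := by
  have hN : (N : ℂ) ≠ 0 := Nat.cast_ne_zero.2 (NeZero.ne N)
  have h1 : ∑ _t : ZMod N, ∑ x ∈ s, F x =
      ∑ x ∈ s, F x * ∑ t : ZMod N, ZMod.stdAddChar (t * c x) := by
    rw [Finset.sum_congr rfl fun t _ => h t, Finset.sum_comm]
    simp only [Finset.mul_sum]
  rw [Finset.sum_const, Finset.card_univ, ZMod.card, nsmul_eq_mul] at h1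
  refine mul_left_cancel₀ hN (h1.trans ?_)
  rw [Finset.sum_filter, Finset.mul_sum]
  refine Finset.sum_congr rfl fun x _ => ?_
  rw [AddChar.sum_mulShift _ (ZMod.isPrimitive_stdAddChar N), ZMod.card]
  split_ifs <;> simp [mul_comm]

theorem conj_stdAddChar (x : ZMod N) :
    (starRingEnd ℂ) (ZMod.stdAddChar x) = ZMod.stdAddChar (-x) :=
  (AddChar.map_neg_eq_conj _ _).symm

theorem stdAddChar_sum {X : Type*} (s : Finset X) (f : X → ZMod N) :
    (ZMod.stdAddChar (∑ x ∈ s, f x) : ℂ) = ∏ x ∈ s, ZMod.stdAddChar (f x) := by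
  classical
  induction s using Finset.induction_on with
  | empty => simp
  | insert x s hx ih =>
    rw [Finset.sum_insert hx, Finset.prod_insert hx, AddChar.map_add_eq_mul, ih]

end Localization

/-! ### The local contribution of a square root to a Kloosterman sum -/

section LocalSum

variable {p n : ℕ} [Fact p.Prime] (hn : 2 ≤ n)

/-- The units congruent to `1` modulo `p`. -/
def oneUnits (p : ℕ) [Fact p.Prime] {n : ℕ} (hn : 2 ≤ n) : Finset (ZMod (p ^ n))ˣ :=
  Finset.univ.filter fun y => red p hn (y : ZMod (p ^ n)) = 1

/-- The part `p ^ (-n / 2) ∑_{y ≡ 1 mod p} e (s (y + y⁻¹) / p ^ n)` of a Kloosterman sum. -/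
def localSum (p : ℕ) [Fact p.Prime] {n : ℕ} (hn : 2 ≤ n) (s : ZMod (p ^ n)) : ℂ :=
  (1 / (Real.sqrt ((p : ℝ) ^ n) : ℂ)) *
    ∑ y ∈ oneUnits p hn,
      ZMod.stdAddChar (s * ((y : ZMod (p ^ n)) + ((y⁻¹ : (ZMod (p ^ n))ˣ) : ZMod (p ^ n))))

theorem mem_oneUnits {y : (ZMod (p ^ n))ˣ} :
    y ∈ oneUnits p hn ↔ red p hn (y : ZMod (p ^ n)) = 1 := by
  simp [oneUnits]

theorem red_inv_of_mem_oneUnits {y : (ZMod (p ^ n))ˣ} (hy : y ∈ oneUnits p hn) :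
    red p hn ((y⁻¹ : (ZMod (p ^ n))ˣ) : ZMod (p ^ n)) = 1 := by
  have h := congrArg (red p hn) (Units.mul_inv y)
  rwa [map_mul, (mem_oneUnits hn).1 hy, one_mul, map_one] at h

theorem inv_mem_oneUnits {y : (ZMod (p ^ n))ˣ} (hy : y ∈ oneUnits p hn) :
    y⁻¹ ∈ oneUnits p hn :=
  (mem_oneUnits hn).2 (red_inv_of_mem_oneUnits hn hy)

theorem mul_mem_oneUnits {y w : (ZMod (p ^ n))ˣ} (hy : y ∈ oneUnits p hn)
    (hw : w ∈ oneUnits p hn) : y * w ∈ oneUnits p hn := by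
  rw [mem_oneUnits] at *
  rw [Units.val_mul, map_mul, hy, hw, one_mul]

theorem sum_oneUnits_sub_one (G : ZMod (p ^ n) → ℂ) :
    ∑ y ∈ oneUnits p hn, G ((y : ZMod (p ^ n)) - 1) =
      ∑ t ∈ Finset.univ.filter (fun x : ZMod (p ^ n) => red p hn x = 0), G t := by
  refine Finset.sum_bij (fun y _ => (y : ZMod (p ^ n)) - 1) ?_ ?_ ?_ fun _ _ => rfl
  · intro y hy
    simp [(mem_oneUnits hn).1 hy]
  · intro y _ w _ h
    exact Units.ext (sub_left_injective h)
  · intro t ht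
    simp only [Finset.mem_filter, Finset.mem_univ, true_and] at ht
    have h1 : red p hn (1 + t) = 1 := by rw [map_add, ht, map_one, add_zero]
    have hu : IsUnit (1 + t) := (isUnit_iff_red_ne_zero hn _).2 (by rw [h1]; exact one_ne_zero)
    exact ⟨hu.unit, by rwa [mem_oneUnits, hu.unit_spec], by rw [hu.unit_spec, add_sub_cancel_left]⟩

theorem card_oneUnits : (oneUnits p hn).card = p ^ (n - 1) := by
  have h := sum_oneUnits_sub_one (p := p) hn fun _ => 1
  rw [Finset.sum_const, Finset.sum_const, card_red_eq] at h
  simp only [nsmul_eq_mul, mul_one] at h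
  exact_mod_cast h

/-- For `v ≡ 1` modulo `p`, the map `w ↦ w - (w v)⁻¹` is a bijection from the classes congruent to
`1` onto the classes congruent to `0`, its derivative being `2` modulo `p`. -/
theorem sum_oneUnits_sub_inv (hp2 : p ≠ 2) {v : (ZMod (p ^ n))ˣ} (hv : v ∈ oneUnits p hn)
    (G : ZMod (p ^ n) → ℂ) :
    ∑ w ∈ oneUnits p hn,
        G ((w : ZMod (p ^ n)) - (((w * v)⁻¹ : (ZMod (p ^ n))ˣ) : ZMod (p ^ n))) =
      ∑ t ∈ Finset.univ.filter (fun x : ZMod (p ^ n) => red p hn x = 0), G t := by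
  set f : (ZMod (p ^ n))ˣ → ZMod (p ^ n) := fun w =>
    (w : ZMod (p ^ n)) - (((w * v)⁻¹ : (ZMod (p ^ n))ˣ) : ZMod (p ^ n)) with hf
  have hmaps : Set.MapsTo f (oneUnits p hn)
      (Finset.univ.filter (fun x : ZMod (p ^ n) => red p hn x = 0)) := by
    intro w hw
    simp only [Finset.coe_filter, Finset.mem_univ, true_and, Set.mem_ofPred_eq, hf, map_sub]
    rw [(mem_oneUnits hn).1 hw, red_inv_of_mem_oneUnits hn (mul_mem_oneUnits hn hw hv), sub_self]
  have hinj : Set.InjOn f (oneUnits p hn) := by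
    intro w hw w' hw' h
    have hu : IsUnit (1 + (((w * v)⁻¹ * w'⁻¹ : (ZMod (p ^ n))ˣ) : ZMod (p ^ n))) := by
      rw [isUnit_iff_red_ne_zero hn, map_add, map_one, (mem_oneUnits hn).1
        (mul_mem_oneUnits hn (inv_mem_oneUnits hn (mul_mem_oneUnits hn hw hv))
          (inv_mem_oneUnits hn hw')), one_add_one_eq_two]
      exact two_ne_zero_of_ne_two hp2
    have h1 : (w : ZMod (p ^ n)) * ((w⁻¹ : (ZMod (p ^ n))ˣ) : ZMod (p ^ n)) = 1 := Units.mul_inv w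
    have h2 : (w' : ZMod (p ^ n)) * ((w'⁻¹ : (ZMod (p ^ n))ˣ) : ZMod (p ^ n)) = 1 :=
      Units.mul_inv w'
    simp only [hf, mul_inv, Units.val_mul] at h hu
    refine Units.ext (sub_eq_zero.1 (hu.mul_left_eq_zero.1 ?_))
    linear_combination h + ((v⁻¹ : (ZMod (p ^ n))ˣ) : ZMod (p ^ n)) *
      ((w'⁻¹ : (ZMod (p ^ n))ˣ) : ZMod (p ^ n)) * h1 -
      ((v⁻¹ : (ZMod (p ^ n))ˣ) : ZMod (p ^ n)) *
      ((w⁻¹ : (ZMod (p ^ n))ˣ) : ZMod (p ^ n)) * h2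
  have hsurj := Finset.surjOn_of_injOn_of_card_le f hmaps hinj
    (by rw [card_oneUnits, card_red_eq])
  refine Finset.sum_bij (fun w _ => f w) (fun w hw => hmaps hw)
    (fun w hw w' hw' h => hinj hw hw' h) (fun t ht => ?_) fun _ _ => rfl
  obtain ⟨w, hw, h⟩ := hsurj ht
  exact ⟨w, hw, h⟩

theorem sum_stdAddChar_mul_eq_zero {u : ZMod (p ^ n)} (hu : red p hn u ≠ 0) :
    ∑ t ∈ Finset.univ.filter (fun x : ZMod (p ^ n) => red p hn x = 0),
      (ZMod.stdAddChar (u * t) : ℂ) = 0 := by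
  rw [sum_eq_sum_filter_of_twist_invariant _ _
    (fun _ => (p : ZMod (p ^ n)) ^ (n - 1) * u), Finset.sum_eq_zero]
  · intro t ht
    exact absurd ((pow_pred_mul_eq_zero_iff hn u).1 (Finset.mem_filter.1 ht).2) hu
  · intro w
    refine (Finset.sum_equiv (Equiv.addRight ((p : ZMod (p ^ n)) ^ (n - 1) * w)) ?_ ?_).symm
    · intro t
      simp [red_pow_pred hn]
    · intro t _
      rw [← AddChar.map_add_eq_mul]
      congr 1
      simp only [Equiv.coe_addRight]
      ring

/-- The sum of `e (s h t / p ^ n)` over the multiples `h` and `t` of `p`. The other `h` can be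
included, because their sums over `t` vanish; then only `t = 0` contributes. -/
theorem sum_sum_stdAddChar {s : ZMod (p ^ n)} (hs : red p hn s ≠ 0) :
    ∑ h ∈ Finset.univ.filter (fun x : ZMod (p ^ n) => red p hn x = 0),
      ∑ t ∈ Finset.univ.filter (fun x : ZMod (p ^ n) => red p hn x = 0),
        (ZMod.stdAddChar (s * h * t) : ℂ) = (p : ℂ) ^ n := by
  have h1 : ∑ h ∈ Finset.univ.filter (fun x : ZMod (p ^ n) => red p hn x = 0),
      ∑ t ∈ Finset.univ.filter (fun x : ZMod (p ^ n) => red p hn x = 0),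
        (ZMod.stdAddChar (s * h * t) : ℂ) = ∑ h : ZMod (p ^ n),
      ∑ t ∈ Finset.univ.filter (fun x : ZMod (p ^ n) => red p hn x = 0),
        (ZMod.stdAddChar (s * h * t) : ℂ) := by
    rw [Finset.sum_filter]
    refine Finset.sum_congr rfl fun h _ => ?_
    split_ifs with h0
    · rfl
    · rw [sum_stdAddChar_mul_eq_zero hn]
      rw [map_mul]
      exact mul_ne_zero hs h0
  have hsu : IsUnit s := (isUnit_iff_red_ne_zero hn s).2 hs
  rw [h1, Finset.sum_comm]
  have h2 : ∀ t : ZMod (p ^ n), ∑ h : ZMod (p ^ n), (ZMod.stdAddChar (s * h * t) : ℂ) =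
      if t = 0 then (p : ℂ) ^ n else 0 := by
    intro t
    have h3 := AddChar.sum_mulShift (s * t) (ZMod.isPrimitive_stdAddChar (p ^ n))
    simp only [ZMod.card, hsu.mul_right_eq_zero] at h3
    rw [Finset.sum_congr rfl fun h _ => by rw [show s * h * t = h * (s * t) by ring], h3]
    split_ifs <;> simp
  rw [Finset.sum_congr rfl fun t _ => h2 t, Finset.sum_ite_eq']
  simp

/-- Writing `y = w v` in the double sum over `w` and `y` turns the exponent
`s (y + y⁻¹ - w - w⁻¹)` into `s (v - 1) (w - (w v)⁻¹)`, where `v - 1` and `w - (w v)⁻¹` run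
independently through the multiples of `p`. -/
theorem localSum_mul_localSum_neg (hp2 : p ≠ 2) {s : ZMod (p ^ n)} (hs : red p hn s ≠ 0) :
    localSum p hn s * localSum p hn (-s) = 1 := by
  have hp : (0 : ℝ) < (p : ℝ) ^ n := pow_pos (Nat.cast_pos.2 (Fact.out : p.Prime).pos) _
  have hsum : (∑ y ∈ oneUnits p hn, (ZMod.stdAddChar
        (s * ((y : ZMod (p ^ n)) + ((y⁻¹ : (ZMod (p ^ n))ˣ) : ZMod (p ^ n)))) : ℂ)) *
      (∑ y ∈ oneUnits p hn, (ZMod.stdAddChar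
        (-s * ((y : ZMod (p ^ n)) + ((y⁻¹ : (ZMod (p ^ n))ˣ) : ZMod (p ^ n)))) : ℂ)) =
      (p : ℂ) ^ n := by
    rw [← sum_sum_stdAddChar hn hs, ← sum_oneUnits_sub_one hn fun h =>
      ∑ t ∈ Finset.univ.filter (fun x : ZMod (p ^ n) => red p hn x = 0),
        (ZMod.stdAddChar (s * h * t) : ℂ)]
    rw [Finset.sum_congr rfl fun v hv => (sum_oneUnits_sub_inv hn hp2 hv _).symm,
      Finset.sum_comm, Finset.sum_mul_sum, Finset.sum_comm]
    refine Finset.sum_congr rfl fun w hw => ?_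
    -- the substitution `y = w v`
    refine Finset.sum_bij' (fun y _ => w⁻¹ * y) (fun v _ => w * v)
      (fun y hy => mul_mem_oneUnits hn (inv_mem_oneUnits hn hw) hy)
      (fun v hv => mul_mem_oneUnits hn hw hv) (fun y _ => mul_inv_cancel_left w y)
      (fun v _ => inv_mul_cancel_left w v) fun y hy => ?_
    rw [← AddChar.map_add_eq_mul, mul_inv_cancel_left]
    congr 1
    have h1 : (w : ZMod (p ^ n)) * ((w⁻¹ : (ZMod (p ^ n))ˣ) : ZMod (p ^ n)) = 1 := Units.mul_inv w
    have h2 : (y : ZMod (p ^ n)) * ((y⁻¹ : (ZMod (p ^ n))ˣ) : ZMod (p ^ n)) = 1 := Units.mul_inv y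
    rw [Units.val_mul]
    linear_combination -s * (y : ZMod (p ^ n)) * h1 + s *
      ((w⁻¹ : (ZMod (p ^ n))ˣ) : ZMod (p ^ n)) * h2
  rw [localSum, localSum, mul_mul_mul_comm, hsum, div_mul_div_comm, one_mul, ← Complex.ofReal_mul,
    Real.mul_self_sqrt hp.le]
  push_cast
  exact one_div_mul_cancel (by exact_mod_cast hp.ne')

theorem localSum_neg (s : ZMod (p ^ n)) :
    localSum p hn (-s) = (starRingEnd ℂ) (localSum p hn s) := by
  simp only [localSum, map_mul, map_sum, conj_stdAddChar, map_div₀, map_one, Complex.conj_ofReal,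
    neg_mul]

theorem norm_localSum (hp2 : p ≠ 2) {s : ZMod (p ^ n)} (hs : red p hn s ≠ 0) :
    ‖localSum p hn s‖ = 1 := by
  have h := localSum_mul_localSum_neg hn hp2 hs
  rw [localSum_neg, Complex.mul_conj, Complex.ofReal_eq_one, Complex.normSq_eq_norm_sq] at h
  exact (pow_eq_one_iff_of_nonneg (norm_nonneg _) two_ne_zero).1 h

/-- Since `y + y⁻¹ ≡ 2` modulo `p`, the local sum varies like `e (2 s / p ^ n)` within the classes
modulo `p ^ (n - 1)`. -/
theorem localSum_add (s u : ZMod (p ^ n)) :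
    localSum p hn (s + (p : ZMod (p ^ n)) ^ (n - 1) * u) =
      localSum p hn s * ZMod.stdAddChar ((p : ZMod (p ^ n)) ^ (n - 1) * (2 * u)) := by
  rw [localSum, localSum, mul_assoc, Finset.sum_mul]
  congr 1
  refine Finset.sum_congr rfl fun y hy => ?_
  rw [← AddChar.map_add_eq_mul]
  congr 1
  have h : red p hn (u * ((y : ZMod (p ^ n)) + ((y⁻¹ : (ZMod (p ^ n))ˣ) : ZMod (p ^ n)))) =
      red p hn (2 * u) := by
    rw [map_mul, map_add, (mem_oneUnits hn).1 hy, red_inv_of_mem_oneUnits hn hy, map_mul,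
      map_ofNat, one_add_one_eq_two, mul_comm]
  rw [← pow_pred_mul_congr hn h]
  ring

/-- Only the `x` with `a x ≡ b x⁻¹` modulo `p` contribute to the Kloosterman sum. -/
theorem kl_eq_sum_filter (a b : ZMod (p ^ n)) :
    kl p n a b = (1 / (Real.sqrt ((p : ℝ) ^ n) : ℂ)) *
      ∑ x ∈ Finset.univ.filter (fun x : (ZMod (p ^ n))ˣ => red p hn (a * (x : ZMod (p ^ n))) =
        red p hn (b * ((x⁻¹ : (ZMod (p ^ n))ˣ) : ZMod (p ^ n)))),
        ZMod.stdAddChar (a * (x : ZMod (p ^ n)) +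
          b * ((x⁻¹ : (ZMod (p ^ n))ˣ) : ZMod (p ^ n))) := by
  rw [kl, sum_eq_sum_filter_of_twist_invariant _ _ fun x : (ZMod (p ^ n))ˣ =>
    (p : ZMod (p ^ n)) ^ (n - 1) * (a * (x : ZMod (p ^ n)) -
      b * ((x⁻¹ : (ZMod (p ^ n))ˣ) : ZMod (p ^ n)))]
  · simp only [pow_pred_mul_eq_zero_iff hn, map_sub, sub_eq_zero]
  · intro t
    have hq := pow_pred_mul_self (p := p) hn
    set q := (p : ZMod (p ^ n)) ^ (n - 1)
    -- the substitution `x ↦ x (1 + q t)`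
    let e : (ZMod (p ^ n))ˣ := ⟨1 + q * t, 1 - q * t, by linear_combination -t ^ 2 * hq,
      by linear_combination -t ^ 2 * hq⟩
    refine (Fintype.sum_equiv (Equiv.mulRight e) _ _ fun x => ?_).symm
    rw [← AddChar.map_add_eq_mul]
    congr 1
    have he : (e : ZMod (p ^ n)) = 1 + q * t := rfl
    have he' : ((e⁻¹ : (ZMod (p ^ n))ˣ) : ZMod (p ^ n)) = 1 - q * t := rfl
    rw [Equiv.coe_mulRight, mul_inv, Units.val_mul, Units.val_mul, he, he']
    ring

theorem kl_eq_zero (hn : 2 ≤ n) (hp2 : p ≠ 2) {a : ZMod (p ^ n)} {b : (ZMod (p ^ n))ˣ}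
    (h : ¬ ∃ u : (ZMod (p ^ n))ˣ, a * b = (u : ZMod (p ^ n)) ^ 2) :
    kl p n a b = 0 := by
  rw [kl_eq_sum_filter hn, Finset.sum_eq_zero, mul_zero]
  intro x hx
  refine absurd ?_ h
  rw [exists_unit_sq_eq_iff hn hp2]
  have hx := (Finset.mem_filter.1 hx).2
  have h1 : red p hn (a * b) =
      red p hn ((b : ZMod (p ^ n)) * ((x⁻¹ : (ZMod (p ^ n))ˣ) : ZMod (p ^ n))) ^ 2 := by
    rw [sq]
    nth_rewrite 1 [← hx]
    rw [← map_mul]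
    congr 1
    linear_combination -a * b * Units.mul_inv x
  rw [h1]
  refine ⟨pow_ne_zero 2 ?_, IsSquare.sq _⟩
  rw [← isUnit_iff_red_ne_zero, ← Units.val_mul]
  exact Units.isUnit _

/-- For `a b = s ^ 2` the Kloosterman sum is the sum of the contributions of the solutions
`x ≡ s / a` and `x ≡ -s / a` of `a x ≡ b x⁻¹` modulo `p`. -/
theorem kl_eq_localSum_add (hp2 : p ≠ 2) {a : ZMod (p ^ n)} {b : (ZMod (p ^ n))ˣ}
    {s : ZMod (p ^ n)} (hs : red p hn s ≠ 0) (hab : a * b = s ^ 2) :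
    kl p n a b = localSum p hn s + localSum p hn (-s) := by
  have hsu : IsUnit s := (isUnit_iff_red_ne_zero hn s).2 hs
  have hau : IsUnit a := isUnit_of_mul_isUnit_left (hab ▸ hsu.pow 2)
  obtain ⟨s, rfl⟩ := hsu
  obtain ⟨a, rfl⟩ := hau
  have hab' : a * b = s ^ 2 := Units.ext (by simpa using hab)
  have h2 := two_ne_zero_of_ne_two hp2
  rw [kl_eq_sum_filter hn, localSum, localSum, ← mul_add]
  congr 1
  have hneg : ∑ y ∈ oneUnits p hn, (ZMod.stdAddChar (-(s : ZMod (p ^ n)) *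
        ((y : ZMod (p ^ n)) + ((y⁻¹ : (ZMod (p ^ n))ˣ) : ZMod (p ^ n)))) : ℂ) =
      ∑ y ∈ Finset.univ.filter (fun y : (ZMod (p ^ n))ˣ => red p hn (y : ZMod (p ^ n)) = -1),
        ZMod.stdAddChar ((s : ZMod (p ^ n)) *
          ((y : ZMod (p ^ n)) + ((y⁻¹ : (ZMod (p ^ n))ˣ) : ZMod (p ^ n)))) := by
    refine Finset.sum_equiv (Equiv.neg _) ?_ ?_
    · intro y
      simp [mem_oneUnits]
    · intro y _
      congr 1
      rw [Equiv.neg_apply, inv_neg, Units.val_neg, Units.val_neg]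
      ring
  have e1 : ∀ x : (ZMod (p ^ n))ˣ,
      (a : ZMod (p ^ n)) * x = s * ((s⁻¹ * a * x : (ZMod (p ^ n))ˣ) : ZMod (p ^ n)) := by
    intro x
    rw [← Units.val_mul, ← Units.val_mul]
    congr 1
    group
  have e2 : ∀ x : (ZMod (p ^ n))ˣ,
      (b : ZMod (p ^ n)) * ((x⁻¹ : (ZMod (p ^ n))ˣ) : ZMod (p ^ n)) =
        s * (((s⁻¹ * a * x)⁻¹ : (ZMod (p ^ n))ˣ) : ZMod (p ^ n)) := by
    intro x
    rw [← Units.val_mul, ← Units.val_mul]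
    congr 1
    rw [show b = a⁻¹ * s ^ 2 by rw [← hab']; group, mul_inv, mul_inv, inv_inv, sq]
    simp only [mul_comm, mul_assoc]
  rw [hneg, oneUnits, ← Finset.sum_union]
  · refine Finset.sum_equiv (Equiv.mulLeft (s⁻¹ * a)) ?_ ?_
    · intro x
      have hx : ∀ y : (ZMod (p ^ n))ˣ,
          red p hn (y : ZMod (p ^ n)) = 1 ∨ red p hn (y : ZMod (p ^ n)) = -1 ↔
          red p hn (y : ZMod (p ^ n)) = red p hn ((y⁻¹ : (ZMod (p ^ n))ˣ) : ZMod (p ^ n)) := by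
        intro y
        have h1 := congrArg (red p hn) (Units.mul_inv y)
        rw [map_mul, map_one] at h1
        have hy0 : red p hn (y : ZMod (p ^ n)) ≠ 0 := left_ne_zero_of_mul_eq_one h1
        rw [← sq_eq_one_iff]
        constructor
        · intro h
          exact mul_left_cancel₀ hy0 (by rw [h1, ← sq, h])
        · intro h
          rw [sq]
          nth_rewrite 2 [h]
          exact h1
      simp only [Finset.mem_filter, Finset.mem_univ, true_and, Finset.mem_union,
        Equiv.coe_mulLeft, hx]
      rw [e1, e2, map_mul, map_mul]
      exact mul_right_inj' hs
    · intro x _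
      rw [e1, e2, ← mul_add, Equiv.coe_mulLeft]
  · rw [Finset.disjoint_filter]
    intro y _ h h'
    refine h2 ?_
    rw [h] at h'
    linear_combination h'

end LocalSum

/-! ### The support of the product of shifted Kloosterman sums -/

section Support

variable {p n : ℕ} [Fact p.Prime] (hn : 2 ≤ n)

open Classical in
/-- The invertible `a` such that `(a + τ) b` is a square unit for every `τ` of positive
multiplicity, described by reduction modulo `p`. -/
def goodSet (p : ℕ) [Fact p.Prime] {n : ℕ} (hn : 2 ≤ n) (b : (ZMod (p ^ n))ˣ)
    (μ : ZMod (p ^ n) → ℕ) : Finset (ZMod (p ^ n)) :=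
  Finset.univ.filter fun a => red p hn a ≠ 0 ∧ ∀ τ ∈ shifts p n μ,
    red p hn ((a + τ) * b) ≠ 0 ∧ IsSquare (red p hn ((a + τ) * b))

theorem mem_goodSet {b : (ZMod (p ^ n))ˣ} {μ : ZMod (p ^ n) → ℕ} {a : ZMod (p ^ n)} :
    a ∈ goodSet p hn b μ ↔ red p hn a ≠ 0 ∧ ∀ τ ∈ shifts p n μ,
      red p hn ((a + τ) * b) ≠ 0 ∧ IsSquare (red p hn ((a + τ) * b)) := by
  simp [goodSet]

theorem mem_shifts {μ : ZMod (p ^ n) → ℕ} {τ : ZMod (p ^ n)} :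
    τ ∈ shifts p n μ ↔ 1 ≤ μ τ := by
  simp [shifts]

theorem mem_goodSet_iff_exists (hp2 : p ≠ 2) {b : (ZMod (p ^ n))ˣ} {μ : ZMod (p ^ n) → ℕ}
    {a : ZMod (p ^ n)} :
    a ∈ goodSet p hn b μ ↔ IsUnit a ∧ ∀ τ ∈ shifts p n μ,
      ∃ u : (ZMod (p ^ n))ˣ, (a + τ) * b = (u : ZMod (p ^ n)) ^ 2 := by
  rw [mem_goodSet, isUnit_iff_red_ne_zero hn]
  simp only [exists_unit_sq_eq_iff hn hp2]

theorem mem_goodSet_congr {b : (ZMod (p ^ n))ˣ} {μ : ZMod (p ^ n) → ℕ} {a a' : ZMod (p ^ n)}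
    (h : red p hn a = red p hn a') : a ∈ goodSet p hn b μ ↔ a' ∈ goodSet p hn b μ := by
  simp only [mem_goodSet, map_mul, map_add, h]

theorem ncard_squareSet_dilate (hp2 : p ≠ 2) (b : (ZMod (p ^ n))ˣ) (μ : ZMod (p ^ n) → ℕ) :
    (squareSet p n (dilate p n b μ)).ncard = (goodSet p hn b μ).card := by
  have hinj : Function.Injective fun a : (ZMod (p ^ n))ˣ =>
      ((b⁻¹ * a : (ZMod (p ^ n))ˣ) : ZMod (p ^ n)) :=
    fun a a' h => mul_left_cancel (Units.ext h)
  have hb : (b : ZMod (p ^ n)) * ((b⁻¹ : (ZMod (p ^ n))ˣ) : ZMod (p ^ n)) = 1 := Units.mul_inv b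
  rw [← Set.ncard_coe_finset, ← Set.ncard_image_of_injective _ hinj]
  congr 1
  ext a
  rw [Finset.mem_coe, mem_goodSet_iff_exists hn hp2]
  constructor
  · rintro ⟨a, ha, rfl⟩
    simp only [Units.val_mul]
    refine ⟨Units.isUnit _ |>.mul (Units.isUnit _), fun τ hτ => ?_⟩
    obtain ⟨u, hu⟩ := ha (b * τ) (by
      rw [mem_shifts, dilate, ← mul_assoc, Units.inv_mul, one_mul]
      exact mem_shifts.1 hτ)
    exact ⟨u, by linear_combination hu + a * hb⟩
  · rintro ⟨⟨a, rfl⟩, ha⟩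
    refine ⟨b * a, fun τ hτ => ?_, by simp⟩
    obtain ⟨u, hu⟩ := ha (((b⁻¹ : (ZMod (p ^ n))ˣ) : ZMod (p ^ n)) * τ)
      (by rwa [mem_shifts, dilate, ← mem_shifts] at hτ)
    refine ⟨u, ?_⟩
    rw [Units.val_mul]
    linear_combination hu - τ * hb

theorem ncard_squareSet_of_isSquare (hp2 : p ≠ 2) {b : (ZMod (p ^ n))ˣ} (hb : IsSquare b)
    (μ : ZMod (p ^ n) → ℕ) :
    (squareSet p n μ).ncard = (goodSet p hn b μ).card := by
  obtain ⟨c, rfl⟩ := hb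
  have hc : (c : ZMod (p ^ n)) * ((c⁻¹ : (ZMod (p ^ n))ˣ) : ZMod (p ^ n)) = 1 := Units.mul_inv c
  rw [← Set.ncard_coe_finset, ← Set.ncard_image_of_injective _ Units.val_injective]
  congr 1
  ext a
  rw [Finset.mem_coe, mem_goodSet_iff_exists hn hp2]
  constructor
  · rintro ⟨a, ha, rfl⟩
    refine ⟨Units.isUnit _, fun τ hτ => ?_⟩
    obtain ⟨u, hu⟩ := ha τ hτ
    refine ⟨u * c, ?_⟩
    rw [Units.val_mul, Units.val_mul, hu]
    ring
  · rintro ⟨⟨a, rfl⟩, ha⟩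
    refine ⟨a, fun τ hτ => ?_, rfl⟩
    obtain ⟨u, hu⟩ := ha τ hτ
    refine ⟨u * c⁻¹, ?_⟩
    rw [Units.val_mul] at hu ⊢
    rw [mul_pow, ← hu]
    linear_combination -((a : ZMod (p ^ n)) + τ) *
      (1 + (c : ZMod (p ^ n)) * ((c⁻¹ : (ZMod (p ^ n))ˣ) : ZMod (p ^ n))) * hc

theorem sum_units_prod_kl (hp2 : p ≠ 2) (b : (ZMod (p ^ n))ˣ) (μ : ZMod (p ^ n) → ℕ) :
    ∑ a : (ZMod (p ^ n))ˣ, ∏ τ : ZMod (p ^ n), kl p n ((a : ZMod (p ^ n)) + τ) b ^ μ τ =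
      ∑ a ∈ goodSet p hn b μ, ∏ τ : ZMod (p ^ n), kl p n (a + τ) b ^ μ τ := by
  classical
  refine Eq.trans (Finset.sum_map Finset.univ ⟨Units.val, Units.val_injective⟩
    fun a => ∏ τ : ZMod (p ^ n), kl p n (a + τ) b ^ μ τ).symm (Eq.symm ?_)
  refine Finset.sum_subset (fun a ha => ?_) fun a ha hag => ?_
  · obtain ⟨u, rfl⟩ := ((mem_goodSet_iff_exists hn hp2).1 ha).1
    simp
  · obtain ⟨u, -, rfl⟩ := Finset.mem_map.1 ha
    rw [mem_goodSet_iff_exists hn hp2] at hag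
    push Not at hag
    obtain ⟨τ, hτ, h⟩ := hag u.isUnit
    refine Finset.prod_eq_zero (Finset.mem_univ τ) ?_
    rw [kl_eq_zero hn hp2 (by push Not; exact h), zero_pow]
    exact Nat.one_le_iff_ne_zero.1 (mem_shifts.1 hτ)

end Support

/-! ### Monomials in the local sums -/

section Monomials

variable {p n : ℕ} [Fact p.Prime] (hn : 2 ≤ n)

theorem IsCompatibleSqrt.red_ne_zero {σ : ZMod (p ^ n) → ZMod (p ^ n)}
    (hσ : IsCompatibleSqrt p hn σ) {c : ZMod (p ^ n)} (h0 : red p hn c ≠ 0)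
    (hs : IsSquare (red p hn c)) : red p hn (σ c) ≠ 0 := by
  intro h
  rw [← (hσ c h0 hs).1, map_pow, h] at h0
  exact h0 (zero_pow two_ne_zero)

/-- A compatible square root is differentiable, with the expected derivative. -/
theorem IsCompatibleSqrt.map_add (hp2 : p ≠ 2) {σ : ZMod (p ^ n) → ZMod (p ^ n)}
    (hσ : IsCompatibleSqrt p hn σ) {c : ZMod (p ^ n)} (h0 : red p hn c ≠ 0)
    (hs : IsSquare (red p hn c)) (t : ZMod (p ^ n)) :
    σ (c + (p : ZMod (p ^ n)) ^ (n - 1) * t) =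
      σ c + (p : ZMod (p ^ n)) ^ (n - 1) * (t * (2 * σ c)⁻¹) := by
  have hq := pow_pred_mul_self (p := p) hn
  have hqr := red_pow_pred (p := p) hn
  set q := (p : ZMod (p ^ n)) ^ (n - 1)
  have hr : red p hn (c + q * t) = red p hn c := by
    rw [_root_.map_add, map_mul, hqr, zero_mul, add_zero]
  have hv : 2 * σ c * (2 * σ c)⁻¹ = 1 := by
    refine ZMod.mul_inv_of_unit _ ((isUnit_iff_red_ne_zero hn _).2 ?_)
    rw [map_mul, map_ofNat]
    exact mul_ne_zero (two_ne_zero_of_ne_two hp2) (hσ.red_ne_zero hn h0 hs)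
  have h1 := (hσ (c + q * t) (by rwa [hr]) (by rwa [hr])).1
  have h2 := (hσ c h0 hs).2 _ hr
  refine eq_of_sq_eq_sq_of_red_eq hn hp2 ?_ ?_ ?_
  · rw [h2]
    exact hσ.red_ne_zero hn h0 hs
  · rw [h1]
    linear_combination -(hσ c h0 hs).1 - q * t * hv - (t * (2 * σ c)⁻¹) ^ 2 * hq
  · rw [h2, _root_.map_add, map_mul, hqr, zero_mul, add_zero]

/-- The monomial with exponents `j τ` and `μ τ - j τ` in the two summands of
`kl p n (a + τ) b`, as a function of `a`. It is used for `j ≤ μ` only, where the subtraction does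
not truncate. -/
def localMonomial (p : ℕ) [Fact p.Prime] {n : ℕ} (hn : 2 ≤ n) (σ : ZMod (p ^ n) → ZMod (p ^ n))
    (b : (ZMod (p ^ n))ˣ) (μ j : ZMod (p ^ n) → ℕ) (a : ZMod (p ^ n)) : ℂ :=
  ∏ τ, (localSum p hn (σ ((a + τ) * b)) ^ j τ * localSum p hn (-σ ((a + τ) * b)) ^ (μ τ - j τ))

/-- The logarithmic derivative `∑ τ, k τ * b / √((a + τ) b)` of a monomial, where
`k τ = 2 j τ - μ τ` is written as `j τ - (μ τ - j τ)`. The inverse is a junk value only where the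
square root is not a unit; at the `a` considered this requires `μ τ = 0`, and then `k τ = 0`. -/
def phaseDeriv (σ : ZMod (p ^ n) → ZMod (p ^ n))
    (b : (ZMod (p ^ n))ˣ) (μ j : ZMod (p ^ n) → ℕ) (a : ZMod (p ^ n)) : ZMod (p ^ n) :=
  ∑ τ, ((j τ : ZMod (p ^ n)) - ((μ τ - j τ : ℕ) : ZMod (p ^ n))) *
    (2 * (b * (2 * σ ((a + τ) * b))⁻¹))

variable {σ : ZMod (p ^ n) → ZMod (p ^ n)} {b : (ZMod (p ^ n))ˣ} {μ j : ZMod (p ^ n) → ℕ}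

theorem exponents_eq_zero (hj : ∀ τ, j τ ≤ μ τ) {τ : ZMod (p ^ n)} (hτ : τ ∉ shifts p n μ) :
    μ τ = 0 ∧ j τ = 0 := by
  rw [mem_shifts] at hτ
  have := hj τ
  omega

theorem localMonomial_add (hp2 : p ≠ 2) (hσ : IsCompatibleSqrt p hn σ) (hj : ∀ τ, j τ ≤ μ τ)
    {a : ZMod (p ^ n)} (ha : a ∈ goodSet p hn b μ) (t : ZMod (p ^ n)) :
    localMonomial p hn σ b μ j (a + (p : ZMod (p ^ n)) ^ (n - 1) * t) =
      localMonomial p hn σ b μ j a *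
        ZMod.stdAddChar (t * ((p : ZMod (p ^ n)) ^ (n - 1) * phaseDeriv σ b μ j a)) := by
  rw [localMonomial, localMonomial, phaseDeriv, Finset.mul_sum, Finset.mul_sum,
    stdAddChar_sum, ← Finset.prod_mul_distrib]
  refine Finset.prod_congr rfl fun τ _ => ?_
  by_cases hτ : τ ∈ shifts p n μ
  · obtain ⟨h0, hs⟩ := ((mem_goodSet hn).1 ha).2 τ hτ
    have h1 : (a + (p : ZMod (p ^ n)) ^ (n - 1) * t + τ) * b =
        (a + τ) * b + (p : ZMod (p ^ n)) ^ (n - 1) * (t * b) := by ring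
    have h2 : ∀ x y : ZMod (p ^ n), -(x + (p : ZMod (p ^ n)) ^ (n - 1) * y) =
        -x + (p : ZMod (p ^ n)) ^ (n - 1) * -y := fun x y => by ring
    rw [h1, hσ.map_add hn hp2 h0 hs, h2, localSum_add, localSum_add, mul_pow, mul_pow,
      ← AddChar.map_nsmul_eq_pow, ← AddChar.map_nsmul_eq_pow, mul_mul_mul_comm,
      ← AddChar.map_add_eq_mul]
    congr 2
    simp only [nsmul_eq_mul]
    ring
  · obtain ⟨h1, h2⟩ := exponents_eq_zero hj hτ
    simp [h1, h2]

theorem sum_localMonomial_eq_sum_filter (hp2 : p ≠ 2) (hσ : IsCompatibleSqrt p hn σ)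
    (hj : ∀ τ, j τ ≤ μ τ) :
    ∑ a ∈ goodSet p hn b μ, localMonomial p hn σ b μ j a =
      ∑ a ∈ (goodSet p hn b μ).filter (fun a => red p hn (phaseDeriv σ b μ j a) = 0),
        localMonomial p hn σ b μ j a := by
  rw [sum_eq_sum_filter_of_twist_invariant _ _
    (fun a => (p : ZMod (p ^ n)) ^ (n - 1) * phaseDeriv σ b μ j a)]
  · simp only [pow_pred_mul_eq_zero_iff hn]
  · intro t
    refine (Finset.sum_equiv (Equiv.addRight ((p : ZMod (p ^ n)) ^ (n - 1) * t)) ?_ ?_).symm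
    · intro a
      refine mem_goodSet_congr hn ?_
      rw [Equiv.coe_addRight, map_add, map_mul, red_pow_pred hn, zero_mul, add_zero]
    · intro a ha
      exact (localMonomial_add hn hp2 hσ hj ha t).symm

theorem norm_localMonomial (hp2 : p ≠ 2) (hσ : IsCompatibleSqrt p hn σ) (hj : ∀ τ, j τ ≤ μ τ)
    {a : ZMod (p ^ n)} (ha : a ∈ goodSet p hn b μ) :
    ‖localMonomial p hn σ b μ j a‖ = 1 := by
  rw [localMonomial, norm_prod]
  refine Finset.prod_eq_one fun τ _ => ?_
  by_cases hτ : τ ∈ shifts p n μ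
  · obtain ⟨h0, hs⟩ := ((mem_goodSet hn).1 ha).2 τ hτ
    have h1 := hσ.red_ne_zero hn h0 hs
    rw [norm_mul, norm_pow, norm_pow, norm_localSum hn hp2 h1,
      norm_localSum hn hp2 (by rwa [map_neg, neg_ne_zero]), one_pow, one_pow, mul_one]
  · obtain ⟨h1, h2⟩ := exponents_eq_zero hj hτ
    simp [h1, h2]

theorem localMonomial_eq_one (hp2 : p ≠ 2) (hσ : IsCompatibleSqrt p hn σ)
    (hj : ∀ τ, 2 * j τ = μ τ) {a : ZMod (p ^ n)} (ha : a ∈ goodSet p hn b μ) :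
    localMonomial p hn σ b μ j a = 1 := by
  rw [localMonomial]
  refine Finset.prod_eq_one fun τ _ => ?_
  by_cases hτ : τ ∈ shifts p n μ
  · obtain ⟨h0, hs⟩ := ((mem_goodSet hn).1 ha).2 τ hτ
    rw [show μ τ - j τ = j τ by have := hj τ; omega, ← mul_pow,
      localSum_mul_localSum_neg hn hp2 (hσ.red_ne_zero hn h0 hs), one_pow]
  · obtain ⟨h1, h2⟩ := exponents_eq_zero (j := j) (μ := μ) (fun τ => by have := hj τ; omega) hτ
    simp [h1, h2]

/-- The critical points of an unbalanced monomial lie in a bounded number of classes modulo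
`p`. -/
theorem card_filter_phaseDeriv_le (hp2 : p ≠ 2) (hσ : IsCompatibleSqrt p hn σ)
    (hj : ∀ τ, j τ ≤ μ τ) (hne : ∃ τ, 2 * j τ ≠ μ τ) {M : ℕ} (hM : ∑ τ, μ τ ≤ M) (hMp : M < p)
    (hdist : (shifts p n μ).card = (shiftsMod p n μ).card) :
    ((goodSet p hn b μ).filter (fun a => red p hn (phaseDeriv σ b μ j a) = 0)).card ≤
      p ^ (n - 1) * (2 ^ M * M) := by
  classical
  let K := AlgebraicClosure (ZMod p)
  let ι := {τ : ZMod (p ^ n) // 2 * j τ ≠ μ τ}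
  have hβ : red p hn b ≠ 0 := (isUnit_iff_red_ne_zero hn _).1 b.isUnit
  have hιs : ∀ τ, 2 * j τ ≠ μ τ → τ ∈ shifts p n μ := by
    intro τ hτ
    by_contra h
    obtain ⟨h1, h2⟩ := exponents_eq_zero hj h
    omega
  let k : ZMod (p ^ n) → ZMod p := fun τ => (j τ : ZMod p) - ((μ τ - j τ : ℕ) : ZMod p)
  have hk0 : ∀ τ, 2 * j τ = μ τ → k τ = 0 := by
    intro τ hτ
    simp only [k]
    rw [show μ τ - j τ = j τ by omega, sub_self]
  have hμp : ∀ τ, μ τ < p := fun τ =>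
    (Finset.single_le_sum (fun _ _ => Nat.zero_le _) (Finset.mem_univ τ)).trans_lt
      (hM.trans_lt hMp)
  have hk : ∀ τ, 2 * j τ ≠ μ τ → k τ ≠ 0 := by
    intro τ hτ h
    have h1 := hμp τ
    have h2 := hj τ
    rw [sub_eq_zero, ZMod.natCast_eq_natCast_iff', Nat.mod_eq_of_lt (by omega),
      Nat.mod_eq_of_lt (by omega)] at h
    omega
  have hinj : Set.InjOn (fun τ : ZMod (p ^ n) => red p hn τ) (shifts p n μ) := by
    have h := Finset.card_image_iff.1 hdist.symm
    intro x hx y hy hxy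
    exact h hx hy (by simpa only [red, ZMod.castHom_apply] using hxy)
  have hcard : Fintype.card ι ≤ M := by
    rw [Fintype.card_subtype]
    refine (Finset.card_le_card (t := shifts p n μ) fun τ hτ => ?_).trans (le_trans ?_ hM)
    · exact hιs τ (Finset.mem_filter.1 hτ).2
    · rw [Finset.card_eq_sum_ones]
      exact (Finset.sum_le_sum fun τ hτ => mem_shifts.1 hτ).trans
        (Finset.sum_le_univ_sum_of_nonneg fun _ => Nat.zero_le _)
  have : Nonempty ι := by
    obtain ⟨τ, hτ⟩ := hne
    exact ⟨⟨τ, hτ⟩⟩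
  let A : ZMod p →+* K := algebraMap (ZMod p) K
  have hA : Function.Injective A := A.injective
  obtain ⟨P, hP0, hPdeg, hP⟩ := exists_polynomial_of_sum_div_sqrt_eq_zero (K := K) (ι := ι)
    (by
      have := hA.ne (two_ne_zero_of_ne_two hp2)
      rwa [map_ofNat, map_zero] at this)
    (fun τ => A (red p hn τ.1 * red p hn b)) (fun τ => A (k τ.1))
    (by
      intro τ τ' h
      exact Subtype.ext (hinj (hιs _ τ.2) (hιs _ τ'.2) (mul_right_cancel₀ hβ (hA h))))
    (by
      intro τ
      rw [Ne, map_eq_zero]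
      exact hk _ τ.2)
  let f : ZMod (p ^ n) → K := fun a => A (red p hn a * red p hn b)
  refine (Finset.card_le_mul_card_image (f := f) _ (p ^ (n - 1)) ?_).trans
    (Nat.mul_le_mul_left _ ?_)
  · intro α hα
    obtain ⟨a, -, rfl⟩ := Finset.mem_image.1 hα
    rw [← card_red_eq hn (red p hn a)]
    refine Finset.card_le_card fun x hx => ?_
    simp only [Finset.mem_filter, Finset.mem_univ, true_and] at hx ⊢
    exact mul_right_cancel₀ hβ (hA hx.2)
  · have hsub : ((goodSet p hn b μ).filter
        (fun a => red p hn (phaseDeriv σ b μ j a) = 0)).image f ⊆ P.roots.toFinset := by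
      intro α hα
      obtain ⟨a, ha, rfl⟩ := Finset.mem_image.1 hα
      obtain ⟨hag, hcrit⟩ := Finset.mem_filter.1 ha
      rw [Multiset.mem_toFinset, Polynomial.mem_roots hP0]
      have hr : ∀ τ, 2 * j τ ≠ μ τ → red p hn (σ ((a + τ) * b)) ≠ 0 := fun τ hτ =>
        hσ.red_ne_zero hn (((mem_goodSet hn).1 hag).2 τ (hιs τ hτ)).1
          (((mem_goodSet hn).1 hag).2 τ (hιs τ hτ)).2
      refine hP _ (fun τ => A (red p hn (σ ((a + τ.1) * b)))) (fun τ => ⟨?_, ?_⟩) ?_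
      · rw [Ne, map_eq_zero]
        exact hr _ τ.2
      · have hg := ((mem_goodSet hn).1 hag).2 τ.1 (hιs _ τ.2)
        simp only [f]
        rw [← map_pow, ← map_pow, (hσ _ hg.1 hg.2).1, ← map_add, ← add_mul, ← map_add, ← map_mul]
      · have h1 : red p hn (phaseDeriv σ b μ j a) =
            red p hn b * ∑ τ : ι, k τ.1 / red p hn (σ ((a + τ.1) * b)) := by
          have h2 : ∀ τ, red p hn (((j τ : ZMod (p ^ n)) - ((μ τ - j τ : ℕ) : ZMod (p ^ n))) *
              (2 * (b * (2 * σ ((a + τ) * b))⁻¹))) = if 2 * j τ ≠ μ τ then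
                red p hn b * (k τ / red p hn (σ ((a + τ) * b))) else 0 := by
            intro τ
            rw [map_mul, map_sub, map_natCast, map_natCast]
            split_ifs with hτ
            · have h20 := two_ne_zero_of_ne_two hp2
              have hv : red p hn (2 * σ ((a + τ) * b)) * red p hn (2 * σ ((a + τ) * b))⁻¹ = 1 := by
                rw [← map_mul, ZMod.mul_inv_of_unit, map_one]
                rw [isUnit_iff_red_ne_zero hn, map_mul, map_ofNat]
                exact mul_ne_zero h20 (hr τ hτ)
              have hv' := eq_inv_of_mul_eq_one_right hv
              rw [map_mul, map_mul, hv', map_mul, map_ofNat]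
              have := hr τ hτ
              simp only [k]
              field_simp
            · exact mul_eq_zero_of_left (hk0 τ (not_not.1 hτ)) _
          rw [phaseDeriv, map_sum, Finset.sum_congr rfl fun τ _ => h2 τ, ← Finset.sum_filter,
            Finset.mul_sum]
          exact Finset.sum_subtype _ (by simp) _
        rw [h1] at hcrit
        have h3 := congrArg A ((mul_eq_zero.1 hcrit).resolve_left hβ)
        rw [map_sum, map_zero] at h3
        simpa only [map_div₀] using h3
    refine (Finset.card_le_card hsub).trans ((Multiset.toFinset_card_le _).trans
      ((Polynomial.card_roots' P).trans (hPdeg.trans ?_)))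
    exact Nat.mul_le_mul (Nat.pow_le_pow_right two_pos hcard) hcard

end Monomials

/-! ### The moments -/

section Moments

variable {p n : ℕ} [Fact p.Prime] (hn : 2 ≤ n)

theorem prod_kl_eq_sum_localMonomial (hp2 : p ≠ 2) {σ : ZMod (p ^ n) → ZMod (p ^ n)}
    (hσ : IsCompatibleSqrt p hn σ) {b : (ZMod (p ^ n))ˣ} {μ : ZMod (p ^ n) → ℕ}
    {a : ZMod (p ^ n)} (ha : a ∈ goodSet p hn b μ) :
    ∏ τ, kl p n (a + τ) b ^ μ τ =
      ∑ j ∈ Fintype.piFinset fun τ => Finset.range (μ τ + 1),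
        ((∏ τ, (μ τ).choose (j τ) : ℕ) : ℂ) * localMonomial p hn σ b μ j a := by
  have h1 : ∀ τ, kl p n (a + τ) b ^ μ τ =
      ∑ i ∈ Finset.range (μ τ + 1), ((μ τ).choose i : ℂ) *
        (localSum p hn (σ ((a + τ) * b)) ^ i *
          localSum p hn (-σ ((a + τ) * b)) ^ (μ τ - i)) := by
    intro τ
    by_cases hτ : τ ∈ shifts p n μ
    · obtain ⟨h0, hs⟩ := ((mem_goodSet hn).1 ha).2 τ hτ
      rw [kl_eq_localSum_add hn hp2 (hσ.red_ne_zero hn h0 hs) (hσ _ h0 hs).1.symm, add_pow]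
      exact Finset.sum_congr rfl fun i _ => mul_comm _ _
    · rw [mem_shifts] at hτ
      simp [show μ τ = 0 by omega]
  rw [Finset.prod_congr rfl fun τ _ => h1 τ, Finset.prod_univ_sum]
  refine Finset.sum_congr rfl fun j _ => ?_
  rw [Finset.prod_mul_distrib, localMonomial]
  push_cast
  rfl

theorem centralProduct_eq_sum (μ : ZMod (p ^ n) → ℕ) :
    centralProduct p n μ = ∑ j ∈ Fintype.piFinset fun τ => Finset.range (μ τ + 1),
      if ∀ τ, 2 * j τ = μ τ then ∏ τ, (μ τ).choose (j τ) else 0 := by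
  have h1 : ∀ τ, (if 2 ∣ μ τ then (μ τ).choose (μ τ / 2) else 0) =
      ∑ i ∈ Finset.range (μ τ + 1), if 2 * i = μ τ then (μ τ).choose i else 0 := by
    intro τ
    split_ifs with h
    · obtain ⟨m, hm⟩ := h
      rw [Finset.sum_eq_single m]
      · rw [if_pos hm.symm]
        congr 1
        omega
      · intro i _ hi
        exact if_neg (by omega)
      · intro h
        exact absurd (Finset.mem_range.2 (by omega)) h
    · exact (Finset.sum_eq_zero fun i _ => if_neg fun hi => h ⟨i, hi.symm⟩).symm
  rw [centralProduct, Finset.prod_congr rfl fun τ _ => h1 τ, Finset.prod_univ_sum]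
  refine Finset.sum_congr rfl fun j _ => ?_
  rw [Finset.prod_ite_zero]
  simp

/-- The balanced monomials give the main term. The binomial coefficients of the others add up to at
most `2 ^ M`, and each of these monomials contributes at most the number of its critical points. -/
theorem norm_sum_prod_kl_sub_le (hp2 : p ≠ 2) (b : (ZMod (p ^ n))ˣ) {μ : ZMod (p ^ n) → ℕ} {M : ℕ}
    (hM : ∑ τ, μ τ ≤ M) (hMp : M < p) (hdist : (shifts p n μ).card = (shiftsMod p n μ).card) :
    ‖∑ a : (ZMod (p ^ n))ˣ, ∏ τ, kl p n ((a : ZMod (p ^ n)) + τ) b ^ μ τ -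
        (centralProduct p n μ : ℂ) * ((goodSet p hn b μ).card : ℂ)‖ ≤
      2 ^ M * ((p : ℝ) ^ (n - 1) * (2 ^ M * M)) := by
  obtain ⟨σ, hσ⟩ := exists_isCompatibleSqrt (p := p) hn hp2
  rw [sum_units_prod_kl hn hp2,
    Finset.sum_congr rfl fun a ha => prod_kl_eq_sum_localMonomial hn hp2 hσ ha,
    Finset.sum_comm, centralProduct_eq_sum, Nat.cast_sum, Finset.sum_mul, ← Finset.sum_sub_distrib]
  have hterm : ∀ j ∈ Fintype.piFinset fun τ => Finset.range (μ τ + 1),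
      ‖∑ a ∈ goodSet p hn b μ,
          ((∏ τ, (μ τ).choose (j τ) : ℕ) : ℂ) * localMonomial p hn σ b μ j a -
        ((if ∀ τ, 2 * j τ = μ τ then ∏ τ, (μ τ).choose (j τ) else 0 : ℕ) : ℂ) *
          ((goodSet p hn b μ).card : ℂ)‖ ≤
      ((∏ τ, (μ τ).choose (j τ) : ℕ) : ℝ) * ((p : ℝ) ^ (n - 1) * (2 ^ M * M)) := by
    intro j hjmem
    have hj : ∀ τ, j τ ≤ μ τ := fun τ =>
      Nat.lt_succ_iff.1 (Finset.mem_range.1 (Fintype.mem_piFinset.1 hjmem τ))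
    rw [← Finset.mul_sum]
    split_ifs with hbal
    · rw [Finset.sum_congr rfl fun a ha => localMonomial_eq_one hn hp2 hσ hbal ha,
        Finset.sum_const, nsmul_eq_mul, mul_one, sub_self, norm_zero]
      positivity
    · rw [Nat.cast_zero, zero_mul, sub_zero, norm_mul, Complex.norm_natCast]
      refine mul_le_mul_of_nonneg_left ?_ (Nat.cast_nonneg _)
      rw [sum_localMonomial_eq_sum_filter hn hp2 hσ hj]
      refine (norm_sum_le_of_le _ fun a ha =>
        (norm_localMonomial hn hp2 hσ hj (Finset.mem_filter.1 ha).1).le).trans ?_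
      rw [Finset.sum_const, nsmul_eq_mul, mul_one]
      exact_mod_cast card_filter_phaseDeriv_le hn hp2 hσ hj (not_forall.1 hbal) hM hMp hdist
  refine (norm_sum_le_of_le _ hterm).trans ?_
  rw [← Finset.sum_mul]
  refine mul_le_mul_of_nonneg_right ?_ (by positivity)
  have h1 : ∑ j ∈ Fintype.piFinset fun τ => Finset.range (μ τ + 1), ∏ τ, (μ τ).choose (j τ) =
      2 ^ ∑ τ, μ τ := by
    rw [← Finset.prod_univ_sum (t := fun τ => Finset.range (μ τ + 1))
      (f := fun τ i => (μ τ).choose i), ← Finset.prod_pow_eq_pow_sum]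
    exact Finset.prod_congr rfl fun τ _ => Nat.sum_range_choose _
  exact_mod_cast h1.le.trans (Nat.pow_le_pow_right two_pos hM)

theorem norm_moment_sub_le (hp2 : p ≠ 2) (b : (ZMod (p ^ n))ˣ) {μ : ZMod (p ^ n) → ℕ} {M : ℕ}
    (hM : ∑ τ, μ τ ≤ M) (hMp : M < p) (hdist : (shifts p n μ).card = (shiftsMod p n μ).card) :
    ‖moment p n μ b - (centralProduct p n μ : ℂ) *
        (((goodSet p hn b μ).card : ℂ) / (Nat.totient (p ^ n) : ℂ))‖ ≤
      2 * (2 ^ M * (2 ^ M * M)) / p := by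
  have hp : p.Prime := Fact.out
  have hp1 : (2 : ℝ) ≤ p := by exact_mod_cast hp.two_le
  have hφ : (Nat.totient (p ^ n) : ℝ) = (p : ℝ) ^ (n - 1) * (p - 1) := by
    rw [Nat.totient_prime_pow hp (by omega)]
    push_cast [hp.one_le]
    rfl
  have hq : (0 : ℝ) < (p : ℝ) ^ (n - 1) := by positivity
  rw [moment, ← mul_div_assoc, one_div,
    div_eq_inv_mul (_ * _) (Nat.totient (p ^ n) : ℂ), ← mul_sub,
    norm_mul, norm_inv, Complex.norm_natCast, hφ]
  refine (mul_le_mul_of_nonneg_left (norm_sum_prod_kl_sub_le hn hp2 b hM hMp hdist)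
    (inv_nonneg.2 (mul_nonneg hq.le (by linarith)))).trans ?_
  have h1 : ((p : ℝ) ^ (n - 1) * (p - 1))⁻¹ * (2 ^ M * ((p : ℝ) ^ (n - 1) * (2 ^ M * M))) =
      (2 ^ M * (2 ^ M * M)) / (p - 1) := by
    have : (p : ℝ) - 1 ≠ 0 := by linarith
    field_simp
  rw [h1, div_le_div_iff₀ (by linarith) (by linarith)]
  have h2 : (0 : ℝ) ≤ 2 ^ M * (2 ^ M * M) := by positivity
  nlinarith

/-- The stated exponent is weaker than `-1`. -/
theorem inv_le_rpow {ε : ℝ} (hε : 0 < ε) (hn : 2 ≤ n) :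
    (p : ℝ)⁻¹ ≤ (p : ℝ) ^ (-(4 * ((n : ℝ) - 1) / 2 ^ n) + ε) := by
  have hp : (1 : ℝ) ≤ p := by exact_mod_cast (Fact.out : p.Prime).one_le
  rw [← Real.rpow_neg_one]
  refine Real.rpow_le_rpow_of_exponent_le hp ?_
  have h : ∀ m : ℕ, 4 * (m + 1) ≤ 2 ^ (m + 2) := by
    intro m
    have := Nat.lt_two_pow_self (n := m)
    rw [pow_add]
    omega
  obtain ⟨m, rfl⟩ := Nat.exists_eq_add_of_le' hn
  have h2 : 4 * (((m + 2 : ℕ) : ℝ) - 1) / 2 ^ (m + 2) ≤ 1 := by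
    rw [div_le_one (by positivity)]
    have : (4 * ((m : ℝ) + 1)) ≤ 2 ^ (m + 2) := by exact_mod_cast h m
    push_cast
    linarith
  linarith

end Moments

end ShiftedKloosterman

end

theorem mainTheorem4 (M : ℕ) (ε : ℝ) (hε : 0 < ε) :
    ∃ C : ℝ, ∀ (p n : ℕ) [Fact p.Prime] (b₀ : (ZMod (p ^ n))ˣ) (μ : ZMod (p ^ n) → ℕ),
      p ≠ 2 → 2 ≤ n →
      ∑ τ : ZMod (p ^ n), μ τ ≤ M →
      (ShiftedKloosterman.shifts p n μ).card = (ShiftedKloosterman.shiftsMod p n μ).card →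
      max (M : ℤ) (2 * (n : ℤ) - 5) < (p : ℤ) →
      ‖ShiftedKloosterman.moment p n μ b₀ -
          (ShiftedKloosterman.centralProduct p n μ : ℂ) *
            (((ShiftedKloosterman.squareSet p n
                (ShiftedKloosterman.dilate p n b₀ μ)).ncard : ℂ) /
              (Nat.totient (p ^ n) : ℂ))‖
          ≤ C * (p : ℝ) ^ (-(4 * ((n : ℝ) - 1) / 2 ^ n) + ε) ∧
      (IsSquare b₀ →
        ‖ShiftedKloosterman.moment p n μ b₀ -
            (ShiftedKloosterman.centralProduct p n μ : ℂ) *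
              (((ShiftedKloosterman.squareSet p n μ).ncard : ℂ) /
                (Nat.totient (p ^ n) : ℂ))‖
            ≤ C * (p : ℝ) ^ (-(4 * ((n : ℝ) - 1) / 2 ^ n) + ε)) := by
  refine ⟨2 * (2 ^ M * (2 ^ M * M)), ?_⟩
  intro p n _ b₀ μ hp2 hn hM hdist hmax
  have hMp : M < p := by exact_mod_cast (le_max_left _ _).trans_lt hmax
  have h := (ShiftedKloosterman.norm_moment_sub_le hn hp2 b₀ hM hMp hdist).trans
    (mul_le_mul_of_nonneg_left (ShiftedKloosterman.inv_le_rpow (p := p) hε hn) (by positivity))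
  refine ⟨?_, fun hb => ?_⟩
  · rw [ShiftedKloosterman.ncard_squareSet_dilate hn hp2]
    exact h
  · rw [ShiftedKloosterman.ncard_squareSet_of_isSquare hn hp2 hb]
    exact h
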